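/- Let $\zeta$ be the Riemann zeta function (analytically continued to $\mathbb{C}\setminus\{1\}$) and write $s=\sigma+it$ with $\sigma,t$ real. Suppose that $$\frac{\partial}{\partial\sigma}\,|\zeta(\sigma+it)|^2<0\qquad\text{for all real } \sigma,t \text{ with } 0<\sigma<\tfrac12,\ |t|>6.5. \tag{A}$$ Then the Riemann hypothesis holds: every zero of $\zeta$ other than the trivial zeros $-2,-4,-6,\dots$ has real part $\tfrac12$; in particular, all non-real zeros of $\zeta$ lie on the line $\sigma=\tfrac12$. -/

import Mathlib

/-! A zero with `0 < σ < 1/2` minimises `|ζ|²` along its horizontal line, so the derivative in (A)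
would vanish there; this excludes `|t| > 6.5`. For `|t| ≤ 6.5`, a zero in the strip forces `Λ₀(s) *
s(1 - s) = 1`, while `|Λ₀(s)| ≤ Λ₀(1) < 0.02339` makes the product too small. The functional
equation reflects the right half of the strip to the left. -/

open Complex MeasureTheory Set HurwitzZeta in
theorem exists_kernel_mellin_completedRiemannZeta₀ :
    ∃ F : ℝ → ℝ, (∀ x, 0 < x → 0 ≤ F x) ∧
      (∀ s : ℂ, MellinConvergent (fun x ↦ (F x : ℂ)) s) ∧
      ∀ s : ℂ, completedRiemannZeta₀ s = mellin (fun x ↦ (F x : ℂ)) (s / 2) / 2 := by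
  set P := hurwitzEvenFEPair 0 with hP
  have key (x : ℝ) (hx : 0 < x) : 1 ≤ evenKernel 0 x := by
    have h := hasSum_int_evenKernel 0 hx
    simpa using le_hasSum h 0 fun n _ ↦ (Real.exp_pos _).le
  have hreal (x : ℝ) : P.f_modif x = (((P.f_modif x).re : ℝ) : ℂ) := by
    simp only [WeakFEPair.f_modif, Pi.add_apply, Set.indicator_apply, hP, hurwitzEvenFEPair]
    split_ifs <;> simp
  refine ⟨fun x ↦ (P.f_modif x).re, fun x hx ↦ ?_, fun s ↦ ?_, fun s ↦ ?_⟩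
  -- The kernel is `θ - 1` for `x > 1`, `θ - x^(-1/2)` for `x < 1` and `0` at `x = 1`; `θ ≥ 1` and
  -- the functional equation of `θ` give the sign.
  · rcases lt_trichotomy x 1 with h | h | h
    · have h1 := evenKernel_functional_equation 0 x
      rw [← evenKernel_eq_cosKernel_of_zero] at h1
      have h2 := key (1 / x) (by positivity)
      have h3 : 0 < x ^ (-(1 / 2) : ℝ) := by positivity
      have h4 : evenKernel 0 x = x ^ (-(1 / 2) : ℝ) * evenKernel 0 (1 / x) := by
        rw [h1, Real.rpow_neg hx.le, one_div]
      simp only [WeakFEPair.f_modif, Pi.add_apply, Set.indicator_apply, hP, hurwitzEvenFEPair,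
        mem_Ioi, mem_Ioo, hx, h, h.not_gt]
      simp only [one_div] at h2 h4
      simp
      rw [h4]
      exact le_mul_of_one_le_right (by positivity) h2
    · simp [WeakFEPair.f_modif, h]
    · have := key x hx
      simp [WeakFEPair.f_modif, hP, hurwitzEvenFEPair, h, h.not_gt, this]
  · simp_rw [← hreal]
    exact (P.isStrongFEPair_toStrongFEPair.hasMellin s).1
  · simp_rw [← hreal]
    rfl

-- As the kernel is nonnegative, `|Λ₀|` is controlled by its values on the real axis; these are
-- log-convex, and the endpoints agree: `Λ₀(0) = Λ₀(1)`.
open Complex MeasureTheory Set in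
theorem norm_completedRiemannZeta₀_le {s : ℂ} (h0 : 0 ≤ s.re) (h1 : s.re ≤ 1) :
    ‖completedRiemannZeta₀ s‖ ≤ (completedRiemannZeta₀ 1).re := by
  obtain ⟨F, hF, hconv, hrep⟩ := exists_kernel_mellin_completedRiemannZeta₀
  have hint (r : ℝ) : IntegrableOn (fun x : ℝ ↦ x ^ (r - 1) * F x) (Ioi 0) := by
    have := (hconv r).re
    refine this.congr ?_
    filter_upwards [ae_restrict_mem measurableSet_Ioi] with x hx
    have : (x : ℂ) ^ ((r : ℂ) - 1) = ((x ^ (r - 1) : ℝ) : ℂ) := by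
      rw [ofReal_cpow (le_of_lt hx)]; push_cast; rfl
    simp [this]
  have hval (r : ℝ) : mellin (fun x ↦ (F x : ℂ)) r
      = ((∫ x in Ioi (0 : ℝ), x ^ (r - 1) * F x : ℝ) : ℂ) := by
    rw [mellin, ← integral_complex_ofReal]
    refine setIntegral_congr_fun measurableSet_Ioi fun x hx ↦ ?_
    simp only [smul_eq_mul]
    rw [ofReal_mul, ofReal_cpow (le_of_lt hx)]
    push_cast; rfl
  have e1 : (completedRiemannZeta₀ 1).re = (∫ x in Ioi (0 : ℝ), x ^ ((1 / 2 : ℝ) - 1) * F x) / 2 := by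
    have := hval (1 / 2)
    push_cast at this
    rw [hrep, this]
    simp
  have e0 : (completedRiemannZeta₀ 1).re = (∫ x in Ioi (0 : ℝ), x ^ ((0 : ℝ) - 1) * F x) / 2 := by
    have := hval 0
    push_cast at this
    rw [← completedRiemannZeta₀_one_sub, sub_self, hrep, zero_div, this]
    simp
  have hbound : ‖mellin (fun x ↦ (F x : ℂ)) (s / 2)‖ ≤ ∫ x in Ioi (0 : ℝ),
      ((1 - s.re) * (x ^ ((0 : ℝ) - 1) * F x) + s.re * (x ^ ((1 / 2 : ℝ) - 1) * F x)) := by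
    refine norm_integral_le_of_norm_le
      (((hint 0).const_mul _).add ((hint (1 / 2)).const_mul _)) ?_
    filter_upwards [ae_restrict_mem measurableSet_Ioi] with x hx
    have hx : 0 < x := hx
    rw [norm_smul, norm_cpow_eq_rpow_re_of_pos hx, norm_real, Real.norm_of_nonneg (hF x hx)]
    have hre : (s / 2 - 1).re = (-1) * (1 - s.re) + (1 / 2 - 1 : ℝ) * s.re := by
      simp; ring
    -- Weighted AM-GM on `x^(σ/2 - 1) = (x^(-1))^(1 - σ) * (x^(-1/2))^σ`.
    have := Real.geom_mean_le_arith_mean2_weighted (sub_nonneg.2 h1) h0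
      (Real.rpow_nonneg hx.le (0 - 1)) (Real.rpow_nonneg hx.le (1 / 2 - 1)) (by ring)
    rw [← Real.rpow_mul hx.le, ← Real.rpow_mul hx.le, ← Real.rpow_add hx] at this
    rw [hre]
    calc _ ≤ _ := mul_le_mul_of_nonneg_right (by simpa using this) (hF x hx)
      _ = _ := by simp; ring
  rw [integral_add ((hint 0).const_mul _) ((hint (1 / 2)).const_mul _), integral_const_mul,
    integral_const_mul] at hbound
  rw [hrep, norm_div, Complex.norm_ofNat]
  linear_combination hbound / 2 - (1 - s.re) * e0 - s.re * e1

/-- The sequence decreases to its limit `γ`: the first term of the series for `log ((1 + y)/(1 -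
y))` at `y = 1/(2n + 2)` is `1/(n + 1)`. The shift `1/2` leaves an error of order `1/n²`, so `n =
10` suffices below. -/
theorem eulerMascheroniConstant_le_harmonic_sub_log_add_half (n : ℕ) :
    Real.eulerMascheroniConstant ≤ harmonic n - Real.log (n + 1 / 2) := by
  have hanti : Antitone fun n : ℕ ↦ (harmonic n : ℝ) - Real.log (n + 1 / 2) := by
    refine antitone_nat_of_succ_le fun n ↦ ?_
    have hx : (0 : ℝ) < 2 * n + 2 := by positivity
    have hx1 : |1 / (2 * n + 2 : ℝ)| < 1 := by
      rw [abs_of_pos (by positivity), div_lt_one hx]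
      have : (0 : ℝ) ≤ n := by positivity
      linarith
    have h := (Real.hasSum_log_sub_log_of_abs_lt_one hx1)
    have h1 := le_hasSum h 0 (fun k _ ↦ by positivity)
    rw [← Real.log_div (by positivity)] at h1
    · have : (1 + 1 / (2 * n + 2 : ℝ)) / (1 - 1 / (2 * n + 2)) = (n + 1 + 1 / 2) / (n + 1 / 2) := by
        have : (1 - 1 / (2 * n + 2 : ℝ)) = (2 * n + 1) / (2 * n + 2) := by field_simp; ring
        rw [this]
        field_simp
      rw [this, Real.log_div (by positivity) (by positivity)] at h1
      rw [harmonic_succ]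
      push_cast
      have h2 : ((n : ℝ) + 1)⁻¹ = 2 * (1 / (2 * n + 2)) := by field_simp
      simp at h1 ⊢
      field_simp at h1 ⊢
      linarith
    · have := (abs_lt.1 hx1).2
      linarith
  refine hanti.le_of_tendsto ?_ n
  refine tendsto_of_tendsto_of_tendsto_of_le_of_le' Real.tendsto_harmonic_sub_log_add_one
    Real.tendsto_harmonic_sub_log (Filter.Eventually.of_forall fun n ↦ ?_) ?_
  · gcongr
    norm_num
  · filter_upwards [Filter.eventually_gt_atTop 0] with n hn
    gcongr
    linarith

theorem completedRiemannZeta₀_one_re_lt : (completedRiemannZeta₀ 1).re < 0.02339 := by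
  have h := eulerMascheroniConstant_le_harmonic_sub_log_add_half 10
  have hval : (completedRiemannZeta₀ 1).re
      = (Real.eulerMascheroniConstant - Real.log (4 * Real.pi)) / 2 + 1 := by
    rw [completedRiemannZeta₀_one]
    have : Complex.log (4 * (Real.pi : ℂ)) = ((Real.log (4 * Real.pi) : ℝ) : ℂ) := by
      rw [Complex.ofReal_log (by positivity)]; push_cast; rfl
    rw [this]
    norm_cast
  have hH : ((harmonic 10 : ℚ) : ℝ) = 7381 / 2520 := by
    norm_num [harmonic, Finset.sum_range_succ]
  have hlog : (4.8822 : ℝ) < Real.log ((10 + 1 / 2) * (4 * Real.pi)) := by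
    rw [Real.lt_log_iff_exp_lt (by positivity)]
    have h1 : Real.exp 1 < 2.7182818286 := Real.exp_one_lt_d9
    have h2 : Real.exp (-0.1178) < 0.88888 := by
      have := Real.exp_bound (x := -0.1178) (by norm_num [abs_le]) (n := 4) (by norm_num)
      have := (abs_le.1 this).2
      norm_num [Finset.sum_range_succ, Nat.factorial] at this ⊢
      linarith
    have h3 : Real.exp 4.8822 = Real.exp 1 ^ 5 * Real.exp (-0.1178) := by
      rw [← Real.exp_nat_mul, ← Real.exp_add]; norm_num
    have h4 : Real.exp 1 ^ 5 < 2.7182818286 ^ 5 := by gcongr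
    have := Real.pi_gt_d4
    have : Real.exp 1 ^ 5 * Real.exp (-0.1178) < 2.7182818286 ^ 5 * 0.88888 := by gcongr
    rw [h3]
    norm_num at *
    linarith
  rw [Real.log_mul (by norm_num) (by positivity)] at hlog
  rw [hval]
  rw [hH] at h
  push_cast at h
  norm_num at *
  linarith

theorem completedRiemannZeta_eq_zero_of_riemannZeta_eq_zero {s : ℂ} (hs : 0 < s.re)
    (h : riemannZeta s = 0) : completedRiemannZeta s = 0 := by
  have hs0 : s ≠ 0 := by rintro rfl; simp at hs
  rw [riemannZeta_def_of_ne_zero hs0, div_eq_zero_iff] at h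
  exact h.resolve_right (Complex.Gammaℝ_ne_zero_of_re_pos hs)

theorem riemannZeta_one_sub_eq_zero {s : ℂ} (h0 : 0 < s.re) (h1 : s.re < 1)
    (h : riemannZeta s = 0) : riemannZeta (1 - s) = 0 := by
  have hs1 : 1 - s ≠ 0 := by
    intro h'
    have := congrArg Complex.re h'
    simp at this
    linarith
  rw [riemannZeta_def_of_ne_zero hs1, completedRiemannZeta_one_sub,
    completedRiemannZeta_eq_zero_of_riemannZeta_eq_zero h0 h, zero_div]

theorem riemannZeta_ne_zero_of_abs_im_le {s : ℂ} (h0 : 0 < s.re) (h1 : s.re < 1)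
    (him : |s.im| ≤ 6.5) : riemannZeta s ≠ 0 := by
  intro h
  have hΛ := completedRiemannZeta_eq_zero_of_riemannZeta_eq_zero h0 h
  have hs0 : s ≠ 0 := by rintro rfl; simp at h0
  have hs1 : 1 - s ≠ 0 := by
    intro h'
    have := congrArg Complex.re h'
    simp at this
    linarith
  have hmul : completedRiemannZeta₀ s * (s * (1 - s)) = 1 := by
    rw [completedRiemannZeta_eq] at hΛ
    field_simp at hΛ
    linear_combination hΛ
  have hle := (norm_completedRiemannZeta₀_le h0.le h1.le).trans completedRiemannZeta₀_one_re_lt.le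
  -- With `u = σ(1 - σ) ≤ 1/4` the square is `u² + t²(1 - 2u) + t⁴ ≤ 1/16 + 6.5² + 6.5⁴ = 1827.375`.
  have hsq : ‖s * (1 - s)‖ ^ 2 ≤ 1827.4 := by
    rw [norm_mul, mul_pow, Complex.sq_norm, Complex.sq_norm, Complex.normSq_apply,
      Complex.normSq_apply]
    simp only [Complex.sub_re, Complex.sub_im, Complex.one_re, Complex.one_im]
    have ht : s.im ^ 2 ≤ 6.5 ^ 2 := sq_le_sq' (abs_le.1 him).1 (abs_le.1 him).2
    have ht4 : (s.im ^ 2) ^ 2 ≤ (6.5 ^ 2) ^ 2 := by gcongr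
    have hu : 0 ≤ s.re * (1 - s.re) := mul_nonneg h0.le (by linarith)
    have hu' : s.re * (1 - s.re) ≤ 1 / 4 := by nlinarith [sq_nonneg (s.re - 1 / 2)]
    have hu2 : (s.re * (1 - s.re)) ^ 2 ≤ (1 / 4) ^ 2 := by gcongr
    have := mul_nonneg (sq_nonneg s.im) hu
    norm_num at ht ht4 ⊢
    linarith
  have hsq1 : ‖completedRiemannZeta₀ s‖ ^ 2 * ‖s * (1 - s)‖ ^ 2 = 1 := by
    rw [← mul_pow, ← norm_mul, hmul]
    simp
  have : ‖completedRiemannZeta₀ s‖ ^ 2 * ‖s * (1 - s)‖ ^ 2 ≤ 0.02339 ^ 2 * 1827.4 := by gcongr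
  rw [hsq1] at this
  norm_num at this

/-- Since `ζ(1 - s) ≠ 0`, also `Λ(s) ≠ 0`, so the zero comes from a pole of `Gammaℝ`. -/
theorem exists_eq_neg_two_mul_of_riemannZeta_eq_zero {s : ℂ} (hs : s.re ≤ 0)
    (h : riemannZeta s = 0) : ∃ n : ℕ, s = -2 * (n + 1) := by
  have hs0 : s ≠ 0 := by
    rintro rfl
    norm_num [riemannZeta_zero] at h
  have hre : 1 ≤ (1 - s).re := by simpa using hs
  have hs1 : 1 - s ≠ 0 := by
    intro h'
    rw [h'] at hre
    norm_num at hre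
  have hne := riemannZeta_ne_zero_of_one_le_re hre
  rw [riemannZeta_def_of_ne_zero hs1, completedRiemannZeta_one_sub, div_ne_zero_iff] at hne
  rw [riemannZeta_def_of_ne_zero hs0, div_eq_zero_iff] at h
  obtain ⟨n, hn⟩ := Complex.Gammaℝ_eq_zero_iff.1 (h.resolve_left hne.1)
  cases n with
  | zero => simp [hs0] at hn
  | succ n => exact ⟨n, by rw [hn]; push_cast; ring⟩

theorem mainTheorem2
    (hA : ∀ σ t : ℝ, 0 < σ → σ < 1 / 2 → 6.5 < |t| →
      deriv (fun x : ℝ => ‖riemannZeta ((x : ℂ) + (t : ℂ) * Complex.I)‖ ^ 2) σ < 0) :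
    RiemannHypothesis := by
  have hleft (s : ℂ) (h0 : 0 < s.re) (h1 : s.re < 1 / 2) : riemannZeta s ≠ 0 := by
    intro h
    rcases le_or_gt |s.im| 6.5 with him | him
    · exact riemannZeta_ne_zero_of_abs_im_le h0 (by linarith) him h
    · refine (hA s.re s.im h0 h1 him).ne (IsLocalMin.deriv_eq_zero ?_)
      refine Filter.Eventually.of_forall fun x ↦ ?_
      simp only [Complex.re_add_im, h, norm_zero, zero_pow two_ne_zero]
      positivity
  intro s h htriv _
  have h0 : 0 < s.re := by
    by_contra! hs
    exact htriv (exists_eq_neg_two_mul_of_riemannZeta_eq_zero hs h)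
  have h1 : s.re < 1 := by
    by_contra! hs
    exact riemannZeta_ne_zero_of_one_le_re hs h
  refine le_antisymm ?_ ?_
  · by_contra! hs
    refine hleft (1 - s) ?_ ?_ (riemannZeta_one_sub_eq_zero h0 h1 h) <;>
      simp only [Complex.sub_re, Complex.one_re] <;> linarith
  · by_contra! hs
    exact hleft s h0 hs h
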